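/- Let $\mathcal{C}$ be a category that has all small colimits. An object of $\textup{pro-}\mathcal{C}$ is a functor from a small cofiltered category to $\mathcal{C}$; the maps from $X\colon I\to\mathcal{C}$ to $Y\colon J\to\mathcal{C}$ are the elements of $\lim_{s\in J}\operatorname{colim}_{t\in I}\operatorname{Hom}_{\mathcal{C}}(X_t,Y_s)$, with the evident composition. Let $A$ be a cofinite category, that is, a small category without non-identity endomorphisms in which every object is the source of only finitely many arrows. Let $I$ be a cofinite directed set (non-empty, directed, with $\{i' : i'\le i\}$ finite for every $i$), regarded as a cofiltered category with an arrow $t\to s$ whenever $t\ge s$. Let $X\colon A\to\textup{pro-}\mathcal{C}$, $a\mapsto X^a$, be a functor with a level representation indexed by $I$: a functor $\tilde X\colon A\times I\to\mathcal{C}$, $(a,s)\mapsto\tilde X^a_s$, together with isomorphisms $X^a\cong\tilde X^a=(\tilde X^a_s)_{s\in I}$ in $\textup{pro-}\mathcal{C}$ that are natural in $a\in A$. Let $K\subseteq\prod_A I$ be the set of all tuples $s=(s_a)_{a\in A}$ such that $s_a\ge s_b$ whenever there is an arrow $a\to b$ in $A$, ordered componentwise; $K$ is a directed set. For $s\in K$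 the objects $\tilde X^a_{s_a}$ form a functor of $a\in A$, in which an arrow $\varphi\colon a\to b$ acts by the map $\tilde X^a_{s_a}\to\tilde X^b_{s_b}$ induced by $\varphi$ and $s_a\ge s_b$. Let $Z$ be the pro-object indexed by $K$ with $$Z_s=\operatorname{colim}^{\mathcal{C}}_{a\in A}\tilde X^a_{s_a}.$$ Then $Z$ is the colimit of the functor $X$ in $\textup{pro-}\mathcal{C}$. The universal cocone has as its component at $a$ the composite $X^a\cong\tilde X^a\to Z$, where the component at $s\in K$ of the second map is represented by the canonical map $\tilde X^a_{s_a}\to Z_s$. -/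

import Mathlib

open CategoryTheory CategoryTheory.Limits Opposite

universe w v u

namespace ProCat

/-! ### Pro-objects and the pro-category -/

/-- A pro-object of `C`: a functor from a small cofiltered category to `C`.
The universe `w` is the one that decides which categories are small. -/
structure Pro (C : Type u) [Category.{v} C] where
  /-- the index category -/
  Index : Type w
  [cat : SmallCategory Index]
  [cofiltered : IsCofiltered Index]
  /-- the underlying diagram -/
  diag : Index ⥤ C

attribute [instance] Pro.cat Pro.cofiltered

variable {C : Type u} [Category.{v} C]

/-- Two maps `X_t ⟶ c`, `X_t' ⟶ c` agree in `colim_t Hom (X_t, c)` iff they agree after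
restriction to some `X_r`, where `r` maps to both `t` and `t'`. -/
def germRel (X : Pro.{w} C) (c : C) (p q : Σ t : X.Index, X.diag.obj t ⟶ c) : Prop :=
  ∃ (r : X.Index) (f : r ⟶ p.1) (g : r ⟶ q.1), X.diag.map f ≫ p.2 = X.diag.map g ≫ q.2

theorem germRel_equivalence (X : Pro.{w} C) (c : C) : Equivalence (germRel X c) where
  refl p := ⟨p.1, 𝟙 _, 𝟙 _, rfl⟩
  symm := fun ⟨r, f, g, h⟩ => ⟨r, g, f, h.symm⟩
  trans := by
    rintro p q z ⟨r, f, g, h⟩ ⟨r', f', g', h'⟩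
    obtain ⟨k, i, j, hk⟩ := IsCofiltered.cospan g f'
    refine ⟨k, i ≫ f, j ≫ g', ?_⟩
    rw [Functor.map_comp, Functor.map_comp, Category.assoc, Category.assoc, h, ← h',
      ← Category.assoc, ← Functor.map_comp, hk, Functor.map_comp, Category.assoc]

/-- The filtered colimit of sets `colim_t Hom (X_t, c)`. -/
def Germ (X : Pro.{w} C) (c : C) : Type (max v w) :=
  Quotient ⟨germRel X c, germRel_equivalence X c⟩

/-- The class of a map `X_t ⟶ c` in `colim_t Hom (X_t, c)`. -/
def Germ.mk {X : Pro.{w} C} {c : C} (t : X.Index) (f : X.diag.obj t ⟶ c) : Germ X c :=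
  Quotient.mk _ ⟨t, f⟩

theorem Germ.sound {X : Pro.{w} C} {c : C} {t t' r : X.Index} {p : X.diag.obj t ⟶ c}
    {q : X.diag.obj t' ⟶ c} (f : r ⟶ t) (g : r ⟶ t')
    (h : X.diag.map f ≫ p = X.diag.map g ≫ q) : Germ.mk t p = Germ.mk t' q :=
  Quotient.sound ⟨r, f, g, h⟩

theorem Germ.mk_eq_mk_iff {X : Pro.{w} C} {c : C} {t t' : X.Index} {p : X.diag.obj t ⟶ c}
    {q : X.diag.obj t' ⟶ c} : Germ.mk t p = Germ.mk t' q ↔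
      ∃ (r : X.Index) (f : r ⟶ t) (g : r ⟶ t'), X.diag.map f ≫ p = X.diag.map g ≫ q :=
  ⟨fun h => Quotient.exact h, fun ⟨_, f, g, h⟩ => Germ.sound f g h⟩

theorem Germ.exists_rep {X : Pro.{w} C} {c : C} (x : Germ X c) :
    ∃ (t : X.Index) (f : X.diag.obj t ⟶ c), x = Germ.mk t f := by
  obtain ⟨⟨t, f⟩, rfl⟩ := Quotient.exists_rep x
  exact ⟨t, f, rfl⟩

/-- Functoriality of `colim_t Hom (X_t, c)` in `c`. -/
def Germ.postcomp {X : Pro.{w} C} {c d : C} (x : Germ X c) (g : c ⟶ d) : Germ X d :=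
  Quotient.lift (fun p : Σ t : X.Index, X.diag.obj t ⟶ c => Germ.mk p.1 (p.2 ≫ g))
    (by
      rintro ⟨t, p⟩ ⟨t', q⟩ ⟨r, f, f', h⟩
      refine Germ.sound f f' ?_
      simp only [← Category.assoc] at h ⊢
      rw [h]) x

@[simp] theorem Germ.postcomp_mk {X : Pro.{w} C} {c d : C} (t : X.Index) (f : X.diag.obj t ⟶ c)
    (g : c ⟶ d) : (Germ.mk t f).postcomp g = Germ.mk t (f ≫ g) := rfl

@[simp] theorem Germ.postcomp_id {X : Pro.{w} C} {c : C} (x : Germ X c) :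
    x.postcomp (𝟙 c) = x := by
  obtain ⟨t, f, rfl⟩ := x.exists_rep
  simp

@[simp] theorem Germ.postcomp_postcomp {X : Pro.{w} C} {c d e : C} (x : Germ X c) (g : c ⟶ d)
    (h : d ⟶ e) : (x.postcomp g).postcomp h = x.postcomp (g ≫ h) := by
  obtain ⟨t, f, rfl⟩ := x.exists_rep
  simp

/-- A map of pro-objects `X ⟶ Y`: an element of `lim_s colim_t Hom (X_t, Y_s)`. -/
@[ext] structure Pro.Hom (X Y : Pro.{w} C) : Type (max v w) where
  /-- the component in `colim_t Hom (X_t, Y_s)` -/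
  germ : ∀ s : Y.Index, Germ X (Y.diag.obj s)
  compat : ∀ {s s' : Y.Index} (f : s ⟶ s'), (germ s).postcomp (Y.diag.map f) = germ s'

/-- Precomposition of an element of `colim_s Hom (Y_s, c)` with a map of pro-objects `X ⟶ Y`:
the class of `g : Y_s ⟶ c` is sent to the composite of the component of `F` at `s` with `g`. -/
def Germ.precomp {X Y : Pro.{w} C} {c : C} (F : Pro.Hom X Y) (y : Germ Y c) : Germ X c :=
  Quotient.lift (fun p : Σ s : Y.Index, Y.diag.obj s ⟶ c => (F.germ p.1).postcomp p.2)
    (by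
      rintro ⟨t, p⟩ ⟨t', q⟩ ⟨r, f, f', h⟩
      dsimp only at f f' h ⊢
      rw [← F.compat f, ← F.compat f', Germ.postcomp_postcomp, Germ.postcomp_postcomp, h]) y

@[simp] theorem Germ.precomp_mk {X Y : Pro.{w} C} {c : C} (F : Pro.Hom X Y) (s : Y.Index)
    (g : Y.diag.obj s ⟶ c) : Germ.precomp F (Germ.mk s g) = (F.germ s).postcomp g := rfl

theorem Germ.precomp_postcomp {X Y : Pro.{w} C} {c d : C} (F : Pro.Hom X Y) (y : Germ Y c)
    (g : c ⟶ d) : (Germ.precomp F y).postcomp g = Germ.precomp F (y.postcomp g) := by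
  obtain ⟨t, f, rfl⟩ := y.exists_rep
  simp

/-- The identity of a pro-object. -/
def Pro.Hom.id (X : Pro.{w} C) : Pro.Hom X X where
  germ s := Germ.mk s (𝟙 _)
  compat {s s'} f := by
    rw [Germ.postcomp_mk]
    exact Germ.sound (𝟙 s) f (by simp)

/-- Composition of maps of pro-objects. -/
def Pro.Hom.comp {X Y Z : Pro.{w} C} (F : Pro.Hom X Y) (G : Pro.Hom Y Z) : Pro.Hom X Z where
  germ s := Germ.precomp F (G.germ s)
  compat f := by rw [Germ.precomp_postcomp, G.compat]

/-- The category `pro-C`. -/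
instance Pro.category : Category.{max v w} (Pro.{w} C) where
  Hom := Pro.Hom
  id := Pro.Hom.id
  comp := Pro.Hom.comp
  id_comp {X Y} F := by
    apply Pro.Hom.ext
    funext s
    change Germ.precomp (Pro.Hom.id X) (F.germ s) = F.germ s
    obtain ⟨t, f, h⟩ := (F.germ s).exists_rep
    rw [h]
    simp [Pro.Hom.id]
  comp_id {X Y} F := by
    apply Pro.Hom.ext
    funext s
    change Germ.precomp F (Germ.mk s (𝟙 _)) = F.germ s
    simp
  assoc {W X Y Z} F G H := by
    apply Pro.Hom.ext
    funext s
    change Germ.precomp (Pro.Hom.comp F G) (H.germ s) =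
      Germ.precomp F (Germ.precomp G (H.germ s))
    obtain ⟨t, f, h⟩ := (H.germ s).exists_rep
    rw [h]
    simp [Pro.Hom.comp, Germ.precomp_postcomp]

@[ext] theorem Pro.hom_ext {X Y : Pro.{w} C} {F G : X ⟶ Y} (h : ∀ s, F.germ s = G.germ s) :
    F = G :=
  Pro.Hom.ext (funext h)

@[simp] theorem Pro.id_germ (X : Pro.{w} C) (s : X.Index) :
    Pro.Hom.germ (𝟙 X) s = Germ.mk s (𝟙 (X.diag.obj s)) := rfl

@[simp] theorem Pro.comp_germ {X Y Z : Pro.{w} C} (F : X ⟶ Y) (G : Y ⟶ Z) (s : Z.Index) :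
    Pro.Hom.germ (F ≫ G) s = Germ.precomp F (G.germ s) := rfl

/-- Diagrams with a fixed index category `J`, as pro-objects; a natural transformation
represents a map of pro-objects. -/
@[simps] def Pro.ofDiagram (J : Type w) [SmallCategory J] [IsCofiltered J] :
    (J ⥤ C) ⥤ Pro.{w} C where
  obj F := { Index := J, diag := F }
  map {F G} η :=
    { germ := fun s => Germ.mk (X := { Index := J, diag := F }) s (η.app s)
      compat := fun {s s'} f => by
        rw [Germ.postcomp_mk]
        exact Germ.sound (X := { Index := J, diag := F }) (𝟙 s) f (by simp) }
  map_id F := rfl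
  map_comp {F G H} η θ := rfl

/-! ### Level representations -/

/-- A level representation, indexed by the cofiltered category `J`, of a diagram `X` of
pro-objects: a functor `A × J ⥤ C` together with isomorphisms of pro-objects from `X^a` to the
pro-object `j ↦ functor (a, j)`, compatible with the maps of `A`. -/
structure LevelRepresentation {A : Type w} [SmallCategory A] (X : A ⥤ Pro.{w} C)
    (J : Type w) [SmallCategory J] [IsCofiltered J] where
  /-- the diagram of diagrams -/
  functor : A × J ⥤ C
  /-- the isomorphisms `X^a ≅ functor (a, -)`, natural in `a` -/
  iso : X ≅ Functor.curry.obj functor ⋙ Pro.ofDiagram J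

/-! ### Cofinite categories and monotone tuples -/

/-- A small category is cofinite if its only endomorphisms are the identities and every object
is the source of only finitely many arrows. -/
class IsCofinite (A : Type w) [SmallCategory A] : Prop where
  loopless : ∀ (a : A) (f : a ⟶ a), f = 𝟙 a
  finite_arrows : ∀ a : A, Finite (Σ b : A, a ⟶ b)

/-- The subset of `∏_A I` of all tuples `s` such that `s a ≥ s b` whenever there is an arrow
`a ⟶ b`. Its ordering is the one it inherits from the product, that is, the componentwise one. -/
abbrev MonotoneTuples (A : Type w) [SmallCategory A] (I : Type w) [Preorder I] : Type w :=
  { s : A → I // ∀ a b : A, Nonempty (a ⟶ b) → s b ≤ s a }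

section Directed

variable {A : Type w} {I : Type w} [Preorder I] [IsDirected I (· ≤ ·)] [Nonempty I]

/-- An upper bound of `s` on a finite set of indices that is monotone in the finite set. -/
theorem exists_monotone_bound (s : A → I) :
    ∃ U : Finset A → I, Monotone U ∧ ∀ F : Finset A, ∀ a ∈ F, s a ≤ U F := by
  classical
  let P : (F : Finset A) → ((G : Finset A) → G ⊂ F → I) → Finset I := fun F ih =>
    F.image s ∪ F.ssubsets.attach.image (fun G => ih G.1 (Finset.mem_ssubsets.1 G.2))
  let ub : Finset I → I := fun T => (Finset.exists_le T).choose
  have hub : ∀ T : Finset I, ∀ i ∈ T, i ≤ ub T := fun T => (Finset.exists_le T).choose_spec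
  let U : Finset A → I := Finset.strongInduction (fun F ih => ub (P F ih))
  have hU : ∀ F, U F = ub (P F (fun G _ => U G)) := fun F => Finset.strongInduction_eq _ _
  refine ⟨U, ?_, ?_⟩
  · intro G F hGF
    rcases hGF.eq_or_ssubset with h | h
    · rw [h]
    · rw [hU F]
      apply hub
      refine Finset.mem_union_right _ (Finset.mem_image.2 ?_)
      exact ⟨⟨G, Finset.mem_ssubsets.2 h⟩, Finset.mem_attach _ _, rfl⟩
  · intro F a ha
    rw [hU F]
    exact hub _ _ (Finset.mem_union_left _ (Finset.mem_image_of_mem s ha))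

variable [SmallCategory A]

theorem MonotoneTuples.exists_ge [IsCofinite A] (s : A → I) :
    ∃ t : MonotoneTuples A I, ∀ a, s a ≤ t.1 a := by
  obtain ⟨U, hU, hs⟩ := exists_monotone_bound s
  have hfin : ∀ a : A, {b : A | Nonempty (a ⟶ b)}.Finite := by
    intro a
    have := IsCofinite.finite_arrows a
    refine (Set.finite_range (fun p : Σ b : A, a ⟶ b => p.1)).subset ?_
    rintro b ⟨f⟩
    exact ⟨⟨b, f⟩, rfl⟩
  refine ⟨⟨fun a => U (hfin a).toFinset, ?_⟩, ?_⟩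
  · rintro a b ⟨f⟩
    refine hU ?_
    intro c hc
    rw [Set.Finite.mem_toFinset] at hc ⊢
    exact ⟨f ≫ hc.some⟩
  · intro a
    apply hs
    rw [Set.Finite.mem_toFinset]
    exact ⟨𝟙 a⟩

/-- The ordered set of monotone tuples is directed. -/
instance MonotoneTuples.isDirected [IsCofinite A] :
    IsDirected (MonotoneTuples A I) (· ≤ ·) where
  directed s t := by
    choose m hm using fun a => exists_ge_ge (s.1 a) (t.1 a)
    obtain ⟨r, hr⟩ := MonotoneTuples.exists_ge m
    exact ⟨r, fun a => (hm a).1.trans (hr a), fun a => (hm a).2.trans (hr a)⟩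

instance MonotoneTuples.nonempty : Nonempty (MonotoneTuples A I) :=
  ⟨⟨fun _ => Classical.arbitrary I, fun _ _ _ => le_rfl⟩⟩

end Directed

/-! ### The pro-object of levelwise colimits

A directed set `I` is regarded as a cofiltered category with an arrow `t ⟶ s` for `t ≥ s`; this is
the category `Iᵒᵖ`. -/

section Colimit

variable {A : Type w} [SmallCategory A] {I : Type w} [Preorder I]

/-- The functor `A × Kᵒᵖ ⥤ C`, `(a, s) ↦ T (a, s_a)`, for `K` the set of monotone tuples. An arrow
`(φ : a ⟶ b, s ≥ t)` is sent to the map `T (a, s_a) ⟶ T (b, t_b)` given by `φ` and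
`s_a ≥ s_b ≥ t_b`. -/
@[simps] def tupleDiagram (T : A × Iᵒᵖ ⥤ C) : A × (MonotoneTuples A I)ᵒᵖ ⥤ C where
  obj p := T.obj (p.1, op (p.2.unop.1 p.1))
  map {p q} f := T.map (X := (p.1, op (p.2.unop.1 p.1))) (Y := (q.1, op (q.2.unop.1 q.1)))
    (f.1, (homOfLE ((leOfHom f.2.unop q.1).trans (p.2.unop.2 p.1 q.1 ⟨f.1⟩))).op)
  map_id p := by
    rw [← T.map_id]
    rfl
  map_comp {p q r} f g := by
    rw [← T.map_comp]
    rfl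

variable [HasColimitsOfSize.{w, w} C]

/-- The diagram `s ↦ colim_a T (a, s_a)`, indexed by the set of monotone tuples. -/
noncomputable def tupleColimit (T : A × Iᵒᵖ ⥤ C) : (MonotoneTuples A I)ᵒᵖ ⥤ C :=
  (Functor.curry.obj (tupleDiagram T)).flip ⋙ colim

/-- The canonical map `T (a, s_a) ⟶ colim_b T (b, s_b)`. -/
noncomputable def tupleColimitι (T : A × Iᵒᵖ ⥤ C) (a : A) (s : MonotoneTuples A I) :
    T.obj (a, op (s.1 a)) ⟶ (tupleColimit T).obj (op s) :=
  colimit.ι ((Functor.curry.obj (tupleDiagram T)).flip.obj (op s)) a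

theorem tupleColimitι_naturality (T : A × Iᵒᵖ ⥤ C) {a b : A} (φ : a ⟶ b)
    (s : MonotoneTuples A I) :
    T.map (X := (a, op (s.1 a))) (Y := (b, op (s.1 b))) (φ, (homOfLE (s.2 a b ⟨φ⟩)).op) ≫
      tupleColimitι T b s = tupleColimitι T a s :=
  colimit.w ((Functor.curry.obj (tupleDiagram T)).flip.obj (op s)) φ

theorem tupleColimitι_map (T : A × Iᵒᵖ ⥤ C) (a : A) {s t : MonotoneTuples A I} (h : t ≤ s) :
    tupleColimitι T a s ≫ (tupleColimit T).map (homOfLE h).op =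
      T.map (X := (a, op (s.1 a))) (Y := (a, op (t.1 a))) (𝟙 a, (homOfLE (h a)).op) ≫
        tupleColimitι T a t :=
  ι_colimMap ((Functor.curry.obj (tupleDiagram T)).flip.map (homOfLE h).op) a

variable [IsDirected I (· ≤ ·)] [Nonempty I] [IsCofinite A]

/-- The pro-object `Z`, indexed by the directed set of monotone tuples, with
`Z_s = colim_a T (a, s_a)`. -/
noncomputable def proColimit (T : A × Iᵒᵖ ⥤ C) : Pro.{w} C where
  Index := (MonotoneTuples A I)ᵒᵖ
  diag := tupleColimit T

/-- The map of pro-objects from `(T (a, i))_i` to `Z` whose component at `s` is represented by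
the canonical map `T (a, s_a) ⟶ colim_b T (b, s_b)`. -/
noncomputable def proColimitι (T : A × Iᵒᵖ ⥤ C) (a : A) :
    (Functor.curry.obj T ⋙ Pro.ofDiagram Iᵒᵖ).obj a ⟶ proColimit T where
  germ := fun s : (MonotoneTuples A I)ᵒᵖ =>
    Germ.mk (X := (Functor.curry.obj T ⋙ Pro.ofDiagram Iᵒᵖ).obj a)
      (op (s.unop.1 a)) (tupleColimitι T a s.unop)
  compat := fun {s s' : (MonotoneTuples A I)ᵒᵖ} (f : s ⟶ s') =>
    Germ.sound (X := (Functor.curry.obj T ⋙ Pro.ofDiagram Iᵒᵖ).obj a)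
      (𝟙 (op (s.unop.1 a))) (homOfLE (leOfHom f.unop a)).op
      ((congrArg (· ≫ _) (((Functor.curry.obj T).obj a).map_id _)).trans
        ((Category.id_comp _).trans (tupleColimitι_map T a (leOfHom f.unop))))

theorem proColimitι_naturality (T : A × Iᵒᵖ ⥤ C) {a b : A} (φ : a ⟶ b) :
    (Functor.curry.obj T ⋙ Pro.ofDiagram Iᵒᵖ).map φ ≫ proColimitι T b = proColimitι T a := by
  apply Pro.hom_ext
  intro (s : (MonotoneTuples A I)ᵒᵖ)
  have h := s.unop.2 a b ⟨φ⟩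
  have key : T.map (X := (a, op (s.unop.1 a))) (Y := (a, op (s.unop.1 b)))
        (𝟙 a, (homOfLE h).op) ≫
      T.map (X := (a, op (s.unop.1 b))) (Y := (b, op (s.unop.1 b))) (φ, 𝟙 _) ≫
        tupleColimitι T b s.unop = tupleColimitι T a s.unop := by
    rw [← tupleColimitι_naturality T φ s.unop, ← Category.assoc, ← T.map_comp]
    congr 2
    exact Prod.ext (Category.id_comp _) rfl
  exact Germ.sound (X := (Functor.curry.obj T ⋙ Pro.ofDiagram Iᵒᵖ).obj a)
    (t := op (s.unop.1 b)) (t' := op (s.unop.1 a)) (homOfLE h).op (𝟙 (op (s.unop.1 a)))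
    (key.trans ((congrArg (· ≫ _) (((Functor.curry.obj T).obj a).map_id _)).trans
      (Category.id_comp _)).symm)

/-- The canonical cocone with vertex `Z` under the diagram of pro-objects `a ↦ (T (a, i))_i`. -/
@[simps] noncomputable def proCocone (T : A × Iᵒᵖ ⥤ C) :
    Cocone (Functor.curry.obj T ⋙ Pro.ofDiagram Iᵒᵖ) where
  pt := proColimit T
  ι :=
    { app := proColimitι T
      naturality := fun _ _ φ => (proColimitι_naturality T φ).trans (Category.comp_id _).symm }

/-- The canonical cocone with vertex `Z` under a diagram `X` with a level representation: its
components are the composites `X^a ≅ (L (a, i))_i ⟶ Z`. -/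
noncomputable def LevelRepresentation.colimitCocone {X : A ⥤ Pro.{w} C}
    (L : LevelRepresentation X Iᵒᵖ) : Cocone X where
  pt := proColimit L.functor
  ι := L.iso.hom ≫ (proCocone L.functor).ι

end Colimit

end ProCat

open ProCat

/-! A map of pro-objects `Z ⟶ Y` is a compatible family of germs in `colim_s Hom (Z_s, c)`, one for
each `c = Y_j`. So the universal property of `Z` reduces to a statement about each object `c` of
`C`: the map from `colim_s Hom (Z_s, c)` to `lim_a colim_i Hom (T (a, i), c)` is bijective. Since
`Hom (Z_s, c)` is `lim_a Hom (T (a, s_a), c)`, this says that a directed colimit over `K` commutes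
with a limit over `A`. Although `A` may be infinite, a level can be chosen separately for each
object, because each `a` takes part in only finitely many conditions: those of the arrows out of
`a`. By `MonotoneTuples.exists_ge`, `K` is cofinal in the full product, so one element of `K` lies
above all the chosen levels. Injectivity is `proColimit_germ_ext`, surjectivity is
`proColimit_germ_exists`. -/

namespace ProCat

section

/-! ### Transition maps and germs of a levelwise diagram -/

variable {C : Type u} [Category.{v} C] {A : Type w} [SmallCategory A] {I : Type w} [Preorder I]

/-- The transition map `T (a, i) ⟶ T (b, j)` given by `a ⟶ b` and `j ≤ i`. -/
def levelMap (T : A × Iᵒᵖ ⥤ C) {a b : A} (φ : a ⟶ b) {i j : I} (h : j ≤ i) :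
    T.obj (a, op i) ⟶ T.obj (b, op j) :=
  T.map (X := (a, op i)) (Y := (b, op j)) (φ, (homOfLE h).op)

theorem levelMap_comp (T : A × Iᵒᵖ ⥤ C) {a b c : A} (φ : a ⟶ b) (ψ : b ⟶ c) {i j k : I}
    (h : j ≤ i) (h' : k ≤ j) :
    levelMap T φ h ≫ levelMap T ψ h' = levelMap T (φ ≫ ψ) (h'.trans h) :=
  (T.map_comp _ _).symm

theorem levelMap_comp_assoc (T : A × Iᵒᵖ ⥤ C) {a b c : A} (φ : a ⟶ b) (ψ : b ⟶ c) {i j k : I}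
    (h : j ≤ i) (h' : k ≤ j) {d : C} (f : T.obj (c, op k) ⟶ d) :
    levelMap T φ h ≫ levelMap T ψ h' ≫ f = levelMap T (φ ≫ ψ) (h'.trans h) ≫ f := by
  rw [← Category.assoc, levelMap_comp]

theorem tupleColimit_hom_ext [HasColimitsOfSize.{w, w} C] (T : A × Iᵒᵖ ⥤ C) {s : MonotoneTuples A I} {c : C}
    {p q : (tupleColimit T).obj (op s) ⟶ c}
    (h : ∀ a, tupleColimitι T a s ≫ p = tupleColimitι T a s ≫ q) : p = q :=
  colimit.hom_ext h

variable [IsDirected I (· ≤ ·)] [Nonempty I]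

theorem level_mk_eq_mk_iff (T : A × Iᵒᵖ ⥤ C) (a : A) {c : C} {i j : I}
    {p : T.obj (a, op i) ⟶ c} {q : T.obj (a, op j) ⟶ c} :
    Germ.mk (X := (Functor.curry.obj T ⋙ Pro.ofDiagram Iᵒᵖ).obj a) (op i) p =
        Germ.mk (X := (Functor.curry.obj T ⋙ Pro.ofDiagram Iᵒᵖ).obj a) (op j) q ↔
      ∃ (r : I) (hi : i ≤ r) (hj : j ≤ r),
        levelMap T (𝟙 a) hi ≫ p = levelMap T (𝟙 a) hj ≫ q := by
  constructor
  · intro h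
    obtain ⟨r, f, g, h⟩ := Germ.mk_eq_mk_iff.1 h
    exact ⟨unop r, leOfHom (Quiver.Hom.unop f), leOfHom (Quiver.Hom.unop g), h⟩
  · rintro ⟨r, hi, hj, h⟩
    exact Germ.mk_eq_mk_iff.2 ⟨op r, (homOfLE hi).op, (homOfLE hj).op, h⟩

/-- The second component of the arrow acting here is the identity of `op i`, which is the arrow
given by `le_rfl`; hence `rfl` suffices. -/
theorem level_map_precomp_mk (T : A × Iᵒᵖ ⥤ C) {a b : A} (φ : a ⟶ b) {c : C} {i : I}
    (p : T.obj (b, op i) ⟶ c) :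
    Germ.precomp ((Functor.curry.obj T ⋙ Pro.ofDiagram Iᵒᵖ).map φ)
        (Germ.mk (X := (Functor.curry.obj T ⋙ Pro.ofDiagram Iᵒᵖ).obj b) (op i) p) =
      Germ.mk (X := (Functor.curry.obj T ⋙ Pro.ofDiagram Iᵒᵖ).obj a) (op i)
        (levelMap T φ le_rfl ≫ p) :=
  rfl

/-! ### The universal property tested on objects of `C` -/

variable [HasColimitsOfSize.{w, w} C] [IsCofinite A]

theorem proColimitι_precomp_mk (T : A × Iᵒᵖ ⥤ C) (a : A) {c : C} (s : MonotoneTuples A I)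
    (p : (tupleColimit T).obj (op s) ⟶ c) :
    Germ.precomp (proColimitι T a) (Germ.mk (X := proColimit T) (op s) p) =
      Germ.mk (X := (Functor.curry.obj T ⋙ Pro.ofDiagram Iᵒᵖ).obj a) (op (s.1 a))
        (tupleColimitι T a s ≫ p) :=
  rfl

/-- `colim_s Hom (Z_s, c)` injects into the product of the `colim_i Hom (T (a, i), c)`. -/
theorem proColimit_germ_ext (T : A × Iᵒᵖ ⥤ C) {c : C} {x y : Germ (proColimit T) c}
    (h : ∀ a, Germ.precomp (proColimitι T a) x = Germ.precomp (proColimitι T a) y) : x = y := by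
  obtain ⟨s, p, rfl⟩ := x.exists_rep
  obtain ⟨t, q, rfl⟩ := y.exists_rep
  obtain ⟨s, rfl⟩ := op_surjective s
  obtain ⟨t, rfl⟩ := op_surjective t
  -- The two germs agree on `T (a, -)` from level `r a` on. These levels are chosen independently
  -- and need not be monotone, so a monotone tuple `m` above them is taken.
  choose r hs ht hr using fun a => (level_mk_eq_mk_iff T a).1 (h a)
  obtain ⟨m, hm⟩ := MonotoneTuples.exists_ge r
  have hsm : s ≤ m := fun a => (hs a).trans (hm a)
  have htm : t ≤ m := fun a => (ht a).trans (hm a)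
  refine Germ.sound (X := proColimit T) (r := op m) (homOfLE hsm).op (homOfLE htm).op ?_
  refine tupleColimit_hom_ext T fun a => ?_
  -- The restriction of `f` from `u` to `m` factors on the summand `a` through level `r a`, where
  -- `hr a` applies.
  have e : ∀ {u : MonotoneTuples A I} (hu : u ≤ m) (hur : u.1 a ≤ r a)
      (f : (tupleColimit T).obj (op u) ⟶ c),
      tupleColimitι T a m ≫ (tupleColimit T).map (homOfLE hu).op ≫ f =
        levelMap T (𝟙 a) (hm a) ≫ levelMap T (𝟙 a) hur ≫ tupleColimitι T a u ≫ f := by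
    intro u hu hur f
    rw [levelMap_comp_assoc, Category.comp_id, ← Category.assoc, tupleColimitι_map T a hu,
      Category.assoc]
    rfl
  exact (e hsm (hs a) p).trans ((congrArg _ (hr a)).trans (e htm (ht a) q).symm)

/-- Every compatible family in the `colim_i Hom (T (a, i), c)` comes from
`colim_s Hom (Z_s, c)`. -/
theorem proColimit_germ_exists (T : A × Iᵒᵖ ⥤ C) {c : C}
    (g : ∀ a, Germ ((Functor.curry.obj T ⋙ Pro.ofDiagram Iᵒᵖ).obj a) c)
    (hg : ∀ {a b : A} (φ : a ⟶ b),
      Germ.precomp ((Functor.curry.obj T ⋙ Pro.ofDiagram Iᵒᵖ).map φ) (g b) = g a) :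
    ∃ x : Germ (proColimit T) c, ∀ a, Germ.precomp (proColimitι T a) x = g a := by
  have rep : ∀ a, ∃ (i : I) (f : T.obj (a, op i) ⟶ c),
      g a = Germ.mk (X := (Functor.curry.obj T ⋙ Pro.ofDiagram Iᵒᵖ).obj a) (op i) f := fun a => by
    obtain ⟨i, f, h⟩ := (g a).exists_rep
    exact ⟨unop i, f, h⟩
  choose i f hf using rep
  -- Compatibility of the germs along an arrow out of `a` becomes an equality of actual maps at some
  -- level of `T (a, -)`.
  have agree : ∀ (a : A) (φ : Σ b : A, a ⟶ b), ∃ (r : I) (hb : i φ.1 ≤ r) (ha : i a ≤ r),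
      levelMap T φ.2 hb ≫ f φ.1 = levelMap T (𝟙 a) ha ≫ f a := by
    rintro a ⟨b, φ⟩
    have h := hg φ
    rw [hf a, hf b] at h
    obtain ⟨r, hb, ha, h⟩ :=
      (level_mk_eq_mk_iff T a).1 ((level_map_precomp_mk T φ (f b)).symm.trans h)
    refine ⟨r, hb, ha, Eq.trans ?_ h⟩
    refine Eq.trans ?_ (levelMap_comp_assoc T (𝟙 a) φ hb le_rfl (f b)).symm
    rw [Category.id_comp]
  choose r hb ha hr using agree
  -- Only finitely many arrows leave `a`, so a single level serves all of them.
  have bound : ∀ a : A, ∃ m : I, ∀ φ : Σ b : A, a ⟶ b, r a φ ≤ m := fun a => by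
    have := IsCofinite.finite_arrows a
    obtain ⟨m, hm⟩ := (Set.finite_range (r a)).bddAbove
    exact ⟨m, fun φ => hm ⟨φ, rfl⟩⟩
  choose m hm using bound
  obtain ⟨s, hs⟩ := MonotoneTuples.exists_ge m
  -- The identity is among the arrows out of `a`, so `m a` also bounds `i a`.
  have his : ∀ a, i a ≤ s.1 a := fun a => (ha a ⟨a, 𝟙 a⟩).trans ((hm a _).trans (hs a))
  -- At the tuple `s` the representatives are strictly compatible: restrict `hr a ⟨b, φ⟩` from its
  -- level to `s.1 a`. They therefore form a cocone and induce a map out of `Z_s`.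
  have w : ∀ {a b : A} (φ : a ⟶ b),
      levelMap T φ (s.2 a b ⟨φ⟩) ≫ levelMap T (𝟙 b) (his b) ≫ f b =
        levelMap T (𝟙 a) (his a) ≫ f a := by
    intro a b φ
    have h := congrArg (levelMap T (𝟙 a) ((hm a ⟨b, φ⟩).trans (hs a)) ≫ ·) (hr a ⟨b, φ⟩)
    simp only [levelMap_comp_assoc, Category.id_comp, Category.comp_id] at h ⊢
    exact h
  let d : Cocone ((Functor.curry.obj (tupleDiagram T)).flip.obj (op s)) :=
    { pt := c
      ι :=
        { app := fun a => levelMap T (𝟙 a) (his a) ≫ f a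
          naturality := fun a b φ => (w φ).trans (Category.comp_id _).symm } }
  refine ⟨Germ.mk (X := proColimit T) (op s) (colimit.desc _ d), fun a => ?_⟩
  have hd : tupleColimitι T a s ≫ colimit.desc _ d = levelMap T (𝟙 a) (his a) ≫ f a :=
    colimit.ι_desc d a
  rw [hf a]
  refine (proColimitι_precomp_mk T a s (colimit.desc _ d)).trans ?_
  refine (level_mk_eq_mk_iff T a).2 ⟨s.1 a, le_rfl, his a, ?_⟩
  refine (congrArg (levelMap T (𝟙 a) le_rfl ≫ ·) hd).trans ?_
  rw [levelMap_comp_assoc, Category.comp_id]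

/-! ### From objects of `C` to arbitrary pro-objects -/

theorem proColimit_hom_ext (T : A × Iᵒᵖ ⥤ C) {Y : Pro.{w} C} {F G : proColimit T ⟶ Y}
    (h : ∀ a, proColimitι T a ≫ F = proColimitι T a ≫ G) : F = G :=
  Pro.hom_ext fun s => proColimit_germ_ext T fun a =>
    congrArg (fun H : _ ⟶ Y => Pro.Hom.germ H s) (h a)

theorem proColimit_exists_desc (T : A × Iᵒᵖ ⥤ C)
    (d : Cocone (Functor.curry.obj T ⋙ Pro.ofDiagram Iᵒᵖ)) :
    ∃ F : proColimit T ⟶ d.pt, ∀ a, proColimitι T a ≫ F = d.ι.app a := by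
  choose x hx using fun s : d.pt.Index =>
    proColimit_germ_exists T (c := d.pt.diag.obj s) (fun a => (d.ι.app a).germ s)
      (fun φ => congrArg (fun H : _ ⟶ d.pt => Pro.Hom.germ H s) (d.w φ))
  refine ⟨{ germ := x, compat := fun {s s'} f => ?_ }, fun a => Pro.hom_ext fun s => hx s a⟩
  -- The germs `x s` were chosen separately for each `s`; injectivity forces their compatibility,
  -- since it can be checked after precomposing with each `proColimitι T a`, where they become the
  -- components of `d.ι.app a`.
  refine proColimit_germ_ext T fun a => ?_
  rw [← Germ.precomp_postcomp, hx, hx]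
  exact (d.ι.app a).compat f

/-- The pro-object of levelwise colimits is the colimit of a diagram given levelwise. -/
noncomputable def proCoconeIsColimit (T : A × Iᵒᵖ ⥤ C) : IsColimit (proCocone T) where
  desc d := (proColimit_exists_desc T d).choose
  fac d := (proColimit_exists_desc T d).choose_spec
  uniq d _ h := proColimit_hom_ext T fun a =>
    (h a).trans ((proColimit_exists_desc T d).choose_spec a).symm

end

end ProCat

theorem theorem9p4 {C : Type u} [Category.{v} C] [HasColimitsOfSize.{w, w} C]
    {A : Type w} [SmallCategory A] [IsCofinite A]
    {I : Type w} [Preorder I] [IsDirected I (· ≤ ·)] [Nonempty I] [IsCofinite Iᵒᵖ]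
    (X : A ⥤ Pro.{w} C) (L : LevelRepresentation X Iᵒᵖ) :
    Nonempty (IsColimit L.colimitCocone) :=
  -- The cocone is the levelwise one precomposed with the natural isomorphism `L.iso`, and this does
  -- not affect being a colimit.
  ⟨(IsColimit.precomposeHomEquiv L.iso (proCocone L.functor)).symm
    (proCoconeIsColimit L.functor)⟩
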